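/- A partition $\mu$ is a weakly decreasing sequence $\mu_1\ge\mu_2\ge\cdots$ of nonnegative integers with finitely many nonzero terms; its weight is the sum of its terms, and it is identified with its Ferrers board. It is strict if its positive parts are pairwise distinct. A partition $\alpha$ contains $\mu$ if one can delete some rows and columns of the Ferrers board of $\alpha$ so that the remaining boxes, after being justified to the top and to the left, form the Ferrers board of $\mu$; otherwise $\alpha$ avoids $\mu$. Let $\mathrm{Av}_n(\mu)$ be the set of partitions of weight $n$ that avoid $\mu$, and let $\sigma_i(n)=\sum_{d\mid n}d^i$. Let $\mu=(k+1,a_0,a_1,\ldots)$ be a strict partition with $k>a_0$ (so $k\ge 1$), where $a_j=0$ beyond the last positive part. Then $$|\mathrm{Av}_n(\mu)| = \frac{n^{k-1}}{(k-1)!\,\prod_{j=0}^{k-1}\bigl(k-(a_j+j)\bigr)}+E(n),$$ where the error term satisfies $E(n)=0$ for all $n\ge 0$ if $k=1$ (with $0^0=1$), and, as $n\to\infty$ with $\mu$ fixed, $E(n)=O(1)$ if $k=2$ and $E(n)=O\bigl(\sigma_{k-2}(n)\log^{k-1}n\bigr)$ if $k\ge 3$. -/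

import Mathlib

namespace PartitionPattern

/-- The partition `μ`, given by its Ferrers board, whose parts are the row lengths
`μ.rowLen 0 ≥ μ.rowLen 1 ≥ ⋯`, is strict: its positive parts are pairwise distinct. -/
def IsStrict (μ : YoungDiagram) : Prop :=
  ∀ i j : ℕ, 0 < μ.rowLen i → μ.rowLen i = μ.rowLen j → i = j

/-- `α` contains `μ`: one can delete rows and columns of the board `α` so that the remaining
boxes, once justified to the top and to the left, form the board `μ`. Here `r i` and `c j` are the
`i`-th row and the `j`-th column that are kept. -/
def Contains (α μ : YoungDiagram) : Prop :=
  ∃ r c : ℕ → ℕ, StrictMono r ∧ StrictMono c ∧ ∀ i j : ℕ, (r i, c j) ∈ α ↔ (i, j) ∈ μ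

/-- The set `Av_n(μ)` of the partitions of `n` that avoid `μ`. -/
def Av (n : ℕ) (μ : YoungDiagram) : Set YoungDiagram :=
  {α | α.card = n ∧ ¬ Contains α μ}

/-- `Av n μ` is finite, so that its `ncard` is its number of elements. -/
theorem finite_Av (n : ℕ) (μ : YoungDiagram) : (Av n μ).Finite := by
  have hinj : Set.InjOn YoungDiagram.cells (Av n μ) := fun a _ b _ h => YoungDiagram.ext h
  refine Set.Finite.of_finite_image (Set.Finite.subset
    (Finset.finite_toSet (Finset.range n ×ˢ Finset.range n).powerset) ?_) hinj
  rintro _ ⟨α, ⟨hα, -⟩, rfl⟩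
  simp only [Finset.coe_powerset, Set.mem_preimage, Set.mem_powerset_iff, Finset.coe_subset]
  rintro ⟨i, j⟩ hij
  have hmem : (i, j) ∈ α := hij
  have h1 : j < α.rowLen i := YoungDiagram.mem_iff_lt_rowLen.1 hmem
  have h2 : i < α.colLen j := YoungDiagram.mem_iff_lt_colLen.1 hmem
  have h3 : α.rowLen i ≤ n := by
    rw [YoungDiagram.rowLen_eq_card, ← hα]
    exact Finset.card_le_card (Finset.filter_subset _ _)
  have h4 : α.colLen j ≤ n := by
    rw [YoungDiagram.colLen_eq_card, ← hα]
    exact Finset.card_le_card (Finset.filter_subset _ _)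
  simp only [Finset.mem_product, Finset.mem_range]
  omega

end PartitionPattern

namespace PartitionPattern

/-! Containment of a strict `μ` is decided greedily. Read part sizes downwards from `n` and place
the columns of `μ` in `α` from right to left; the state is the number of columns placed. If the next
column is the last one of some row of `μ`, the scan must wait for a part of exactly the current
size. These waiting states are the set `S`; from every other state the scan moves on at each size.
By strictness each such column closes a single row, so one part suffices, and `α` contains `μ`
exactly when the final state exceeds `k` (`contains_iff_lt_scan`).

Hence the avoiders are counted by the final states `0, …, k`. Let `W i e R` count the partitions of
`R` into parts greater than `e` that end in state `i`. Sorting by the multiplicity of the part `e +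
1` gives the recurrence `IsScanCount`. For `i ≥ 1` its solution is close to `c_i R ^ (i - 1) / ((e +
1) ⋯ (e + f))`, where `f` is the number of non-waiting states in `[1, i]`. Summing a power of `R`
along an arithmetic progression of difference `e + 1` raises the power by one and divides by `e +
1`. Entering a non-waiting state adds this factor to the denominator; entering a waiting state also
sums over all larger `e`, which telescopes and contributes `1 / f` to the constant.

The error is carried along in `IsScanCount.asymptotic`: each new state costs at most a factor `R`
times a harmonic number. At `e = 0` the factors `1 / f` from the waiting states, with the final
`f!`, form the product over `k - (a_j + j)` (`leadTerm_rowStates`). State `k` gives the main term;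
lower states fall within the error `(n H_n) ^ (k - 2)`. -/

open Finset

/-! ### Power sums along arithmetic progressions. -/

/-- The sum of the `q`-th powers of `R, R - d, R - 2 d, …`, as long as these are nonnegative, is
`R ^ (q + 1) / ((q + 1) d)` up to an error in `[0, R ^ q]`. -/
theorem sum_pow_arith_bounds (q d : ℕ) (hd : 0 < d) (R : ℕ) :
    (R : ℝ) ^ (q + 1) / ((q + 1) * d) ≤ ∑ m ∈ range (R / d + 1), ((R - m * d : ℕ) : ℝ) ^ q ∧
    ∑ m ∈ range (R / d + 1), ((R - m * d : ℕ) : ℝ) ^ q ≤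
      (R : ℝ) ^ (q + 1) / ((q + 1) * d) + (R : ℝ) ^ q := by
  have hd' : (0 : ℝ) < d := by exact_mod_cast hd
  have hq : (0 : ℝ) < (q + 1 : ℝ) * d := by positivity
  induction R using Nat.strong_induction_on with
  | _ R ih =>
  rcases lt_or_ge R d with h | h
  · have hR : (R : ℝ) ≤ d := by exact_mod_cast h.le
    rw [Nat.div_eq_of_lt h]
    simp only [zero_add, range_one, sum_singleton, zero_mul, tsub_zero]
    refine ⟨?_, by have : (0 : ℝ) ≤ (R : ℝ) ^ (q + 1) / ((q + 1) * d) := by positivity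
                   linarith⟩
    rw [div_le_iff₀ hq, pow_succ]
    have h1 : (R : ℝ) ≤ (q + 1) * d := by nlinarith [(Nat.cast_nonneg q : (0 : ℝ) ≤ q)]
    exact mul_le_mul_of_nonneg_left h1 (by positivity)
  · obtain ⟨r, rfl⟩ := Nat.exists_eq_add_of_le' h
    obtain ⟨ih1, ih2⟩ := ih r (by omega)
    have hs : ∑ m ∈ range ((r + d) / d + 1), ((r + d - m * d : ℕ) : ℝ) ^ q
        = ∑ m ∈ range (r / d + 1), ((r - m * d : ℕ) : ℝ) ^ q + ((r + d : ℕ) : ℝ) ^ q := by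
      rw [Nat.add_div_right _ hd, sum_range_succ']
      simp only [Nat.add_mul, one_mul, Nat.add_sub_add_right, zero_mul, tsub_zero]
    have hr : (0 : ℝ) ≤ r := Nat.cast_nonneg r
    -- Passing from `r` to `r + d` adds one term `(r + d) ^ q` to the sum. The main term grows by
    -- the mean of the `q + 1` products in this factorization, which lies between `r ^ q` and `(r +
    -- d) ^ q`.
    have hg := (Commute.all ((r : ℝ) + d) (r : ℝ)).mul_geom_sum₂ (q + 1)
    rw [add_sub_cancel_left] at hg
    have hup : ∑ i ∈ range (q + 1), ((r : ℝ) + d) ^ i * (r : ℝ) ^ (q + 1 - 1 - i)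
        ≤ (q + 1) * ((r : ℝ) + d) ^ q := by
      have : ∀ i ∈ range (q + 1), ((r : ℝ) + d) ^ i * (r : ℝ) ^ (q + 1 - 1 - i)
          ≤ ((r : ℝ) + d) ^ q := by
        intro i hi
        have hi' : i + (q + 1 - 1 - i) = q := by have := mem_range.1 hi; omega
        conv_rhs => rw [← hi', pow_add]
        gcongr
        linarith
      simpa using sum_le_card_nsmul _ _ _ this
    have hlo : (q + 1) * (r : ℝ) ^ q ≤
        ∑ i ∈ range (q + 1), ((r : ℝ) + d) ^ i * (r : ℝ) ^ (q + 1 - 1 - i) := by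
      have : ∀ i ∈ range (q + 1), (r : ℝ) ^ q ≤
          ((r : ℝ) + d) ^ i * (r : ℝ) ^ (q + 1 - 1 - i) := by
        intro i hi
        have hi' : i + (q + 1 - 1 - i) = q := by have := mem_range.1 hi; omega
        conv_lhs => rw [← hi', pow_add]
        gcongr
        linarith
      simpa using card_nsmul_le_sum _ _ _ this
    have e1 : ((r : ℝ) + d) ^ (q + 1) / ((q + 1) * d) ≤
        (r : ℝ) ^ (q + 1) / ((q + 1) * d) + ((r : ℝ) + d) ^ q := by
      rw [div_add' _ _ _ hq.ne', div_le_div_iff_of_pos_right hq]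
      nlinarith
    have e2 : (r : ℝ) ^ (q + 1) / ((q + 1) * d) + (r : ℝ) ^ q ≤
        ((r : ℝ) + d) ^ (q + 1) / ((q + 1) * d) := by
      rw [div_add' _ _ _ hq.ne', div_le_div_iff_of_pos_right hq]
      nlinarith
    rw [hs]
    push_cast
    constructor <;> linarith

/-! ### The scan recurrence and its leading terms. -/

/-- The sum over `m` of `W i (e + 1) (R - m (e + 1))`, where `m = 0` is left out if `i ∈ S`. -/
def transfer (S : Finset ℕ) (W : ℕ → ℕ → ℕ → ℕ) (i e R : ℕ) : ℕ :=
  ∑ m ∈ range (R / (e + 1) + 1), if i ∈ S ∧ m = 0 then 0 else W i (e + 1) (R - m * (e + 1))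

/-- The recurrence satisfied by the numbers `W i e R` of partitions of `R` into parts greater
than `e` whose scan, from part size `n` down to `e + 1`, ends in state `i`. -/
structure IsScanCount (S : Finset ℕ) (n : ℕ) (W : ℕ → ℕ → ℕ → ℕ) : Prop where
  base : ∀ i R, W i n R = if i = 0 ∧ R = 0 then 1 else 0
  zero : ∀ e R, e ≤ n → W 0 e R = if R = 0 then 1 else 0
  step : ∀ i e R, e < n →
    W (i + 1) e R = (if i + 1 ∈ S then W (i + 1) (e + 1) R else 0) + transfer S W i e R

/-- The product `(e + 1) (e + 2) ⋯ (e + f)`. -/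
def risingProd (f e : ℕ) : ℝ := ∏ j ∈ range f, ((e : ℝ) + 1 + j)

theorem risingProd_pos (f e : ℕ) : 0 < risingProd f e := prod_pos fun j _ => by positivity

theorem risingProd_succ (f e : ℕ) : risingProd (f + 1) e = risingProd f e * (e + 1 + f) := by
  rw [risingProd, prod_range_succ, risingProd]

theorem risingProd_succ' (f e : ℕ) : risingProd (f + 1) e = (e + 1) * risingProd f (e + 1) := by
  rw [risingProd, prod_range_succ', risingProd, mul_comm]
  congr 1
  · simp
  · refine prod_congr rfl fun j _ => ?_
    push_cast; ring

theorem pow_le_risingProd (f e : ℕ) : ((e : ℝ) + 1) ^ f ≤ risingProd f e := by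
  have h : ∏ _j ∈ range f, ((e : ℝ) + 1) ≤ risingProd f e :=
    prod_le_prod (fun j _ => by positivity) fun j _ => by
      have : (0 : ℝ) ≤ j := Nat.cast_nonneg j
      linarith
  simpa using h

theorem risingProd_zero_right (f : ℕ) : risingProd f 0 = (f.factorial : ℝ) := by
  induction f with
  | zero => simp [risingProd]
  | succ f ih => rw [risingProd_succ, ih, Nat.factorial_succ]; push_cast; ring

/-- Telescoping of the reciprocals of products of consecutive integers. -/
theorem inv_risingProd_sub (f e : ℕ) :
    1 / risingProd f e - 1 / risingProd f (e + 1) = f / risingProd (f + 1) e := by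
  have h1 := risingProd_succ f e
  have h2 := risingProd_succ' f e
  have p1 := risingProd_pos f e
  have p2 := risingProd_pos f (e + 1)
  have he : (0 : ℝ) < (e : ℝ) + 1 := by positivity
  have hf : (0 : ℝ) < (e : ℝ) + 1 + f := by positivity
  have h3 : 1 / risingProd f e = (e + 1 + f) / risingProd (f + 1) e := by
    rw [h1]; field_simp
  have h4 : 1 / risingProd f (e + 1) = (e + 1) / risingProd (f + 1) e := by
    rw [h2]; field_simp
  rw [h3, h4]; ring

/-- The number of elements of `[1, i]` outside `S`. -/
def freeCount (S : Finset ℕ) : ℕ → ℕ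
  | 0 => 0
  | i + 1 => if i + 1 ∈ S then freeCount S i else freeCount S i + 1

/-- The coefficient of the leading term of the scan count of state `i ≥ 1`. -/
noncomputable def leadCoeff (S : Finset ℕ) : ℕ → ℝ
  | 0 => 1
  | 1 => 1
  | i + 2 => if i + 2 ∈ S then leadCoeff S (i + 1) / ((i + 1) * freeCount S (i + 1))
      else leadCoeff S (i + 1) / (i + 1)

theorem leadCoeff_nonneg (S : Finset ℕ) (i : ℕ) : 0 ≤ leadCoeff S i := by
  induction i using Nat.strong_induction_on with
  | _ i ih =>
  match i with
  | 0 => simp [leadCoeff]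
  | 1 => simp [leadCoeff]
  | i + 2 =>
    have := ih (i + 1) (by omega)
    rw [leadCoeff]
    split_ifs <;> positivity

/-- The leading term of the scan count. -/
noncomputable def leadTerm (S : Finset ℕ) (i e R : ℕ) : ℝ :=
  leadCoeff S i * (R : ℝ) ^ (i - 1) / risingProd (freeCount S i) e

/-- For `R ≤ e` the count vanishes, so the leading term itself must fit into the error. Trading one
factor `R` for `e + 1` cancels one factor of the denominator. -/
theorem leadTerm_le_of_le (S : Finset ℕ) (i e R g : ℕ) (hg : g + 1 ≤ freeCount S (i + 2))
    (h : R ≤ e + 1) :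
    leadTerm S (i + 2) e R ≤ leadCoeff S (i + 2) * ((R : ℝ) ^ i / ((e : ℝ) + 1) ^ g) := by
  have hc := leadCoeff_nonneg S (i + 2)
  have h1 := pow_le_risingProd (freeCount S (i + 2)) e
  have h2 : ((e : ℝ) + 1) ^ (g + 1) ≤ ((e : ℝ) + 1) ^ freeCount S (i + 2) :=
    pow_le_pow_right₀ (by linarith [(Nat.cast_nonneg e : (0 : ℝ) ≤ e)]) hg
  have hR : (R : ℝ) ≤ e + 1 := by exact_mod_cast h
  rw [leadTerm, mul_div_assoc]
  refine mul_le_mul_of_nonneg_left ?_ hc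
  rw [show i + 2 - 1 = i + 1 by omega]
  calc (R : ℝ) ^ (i + 1) / risingProd (freeCount S (i + 2)) e
      ≤ (R : ℝ) ^ (i + 1) / ((e : ℝ) + 1) ^ (g + 1) := by
        gcongr; exact h2.trans h1
    _ ≤ ((R : ℝ) ^ i * (e + 1)) / ((e : ℝ) + 1) ^ (g + 1) := by
        rw [pow_succ]; gcongr
    _ = (R : ℝ) ^ i / ((e : ℝ) + 1) ^ g := by
        rw [pow_succ]; field_simp

theorem leadTerm_nonneg (S : Finset ℕ) (i e R : ℕ) : 0 ≤ leadTerm S i e R :=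
  div_nonneg (mul_nonneg (leadCoeff_nonneg S i) (by positivity)) (risingProd_pos _ _).le

/-- The leading term of the transfer sum. -/
theorem leadTerm_of_notMem (S : Finset ℕ) (i e R : ℕ) (h : i + 2 ∉ S) :
    leadTerm S (i + 2) e R = leadCoeff S (i + 1) * (R : ℝ) ^ (i + 1) / (i + 1) /
      risingProd (freeCount S (i + 1) + 1) e := by
  rw [leadTerm, leadCoeff, if_neg h, freeCount, if_neg h, show i + 2 - 1 = i + 1 by omega]
  ring

/-- In a waiting state the recurrence prescribes the difference between `e` and `e + 1`; the factor
`1 / freeCount` in `leadCoeff` is what makes the telescoping identity match it. -/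
theorem leadTerm_sub_of_mem (S : Finset ℕ) (i e R : ℕ) (h : i + 2 ∈ S)
    (hf : 1 ≤ freeCount S (i + 1)) :
    leadTerm S (i + 2) e R - leadTerm S (i + 2) (e + 1) R =
      leadCoeff S (i + 1) * (R : ℝ) ^ (i + 1) / (i + 1) /
        risingProd (freeCount S (i + 1) + 1) e := by
  have hf' : (freeCount S (i + 1) : ℝ) ≠ 0 := by positivity
  have h1 := inv_risingProd_sub (freeCount S (i + 1)) e
  have e1 : ∀ e, leadTerm S (i + 2) e R = leadCoeff S (i + 1) * (R : ℝ) ^ (i + 1) /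
      ((i + 1) * freeCount S (i + 1)) * (1 / risingProd (freeCount S (i + 1)) e) := by
    intro e
    have hfc : freeCount S (i + 2) = freeCount S (i + 1) := if_pos h
    rw [leadTerm, leadCoeff, if_pos h, hfc, show i + 2 - 1 = i + 1 by omega]
    ring
  rw [e1, e1, ← mul_sub, h1]
  field_simp

theorem freeCount_pos (S : Finset ℕ) (h1 : 1 ∉ S) (i : ℕ) : 1 ≤ freeCount S (i + 1) := by
  induction i with
  | zero => simp [freeCount, h1]
  | succ i ih => rw [freeCount]; split_ifs <;> omega

/-! ### Exact counts in the lowest states. -/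

/-- State `0` is left only at a part that is present, and such a part exceeds `e`. -/
theorem IsScanCount.eq_zero {S : Finset ℕ} {n : ℕ} {W : ℕ → ℕ → ℕ → ℕ} (hW : IsScanCount S n W)
    (h0 : 0 ∈ S) (i e R : ℕ) (he : e ≤ n) (hR : R ≤ e) : W (i + 1) e R = 0 := by
  induction he using Nat.decreasingInduction generalizing i with
  | self => rw [hW.base, if_neg (by omega)]
  | of_succ e he ih =>
    rw [hW.step i e R (by omega), ih i (by omega), transfer, Nat.div_eq_of_lt (by omega)]
    rcases i with _ | i
    · simp [h0]
    · simp [ih i (by omega)]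

/-- State `1` is not a waiting state, so it is occupied only right after the largest part has been
read: all parts equal `e + 1`. -/
theorem IsScanCount.state_one {S : Finset ℕ} {n : ℕ} {W : ℕ → ℕ → ℕ → ℕ} (hW : IsScanCount S n W)
    (h0 : 0 ∈ S) (h1 : 1 ∉ S) (e R : ℕ) (he : e ≤ n) (hR : R ≤ n) :
    W 1 e R = if 1 ≤ R ∧ e + 1 ∣ R then 1 else 0 := by
  rcases he.eq_or_lt with rfl | he
  · rw [hW.base, if_neg (by omega), if_neg]
    rintro ⟨h, h'⟩
    have := Nat.le_of_dvd h h'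
    omega
  · rw [hW.step 0 e R he, zero_add, if_neg h1, zero_add, transfer]
    simp only [h0, true_and]
    have key : ∀ m ∈ range (R / (e + 1) + 1),
        (if m = 0 then 0 else W 0 (e + 1) (R - m * (e + 1))) =
        if m = R / (e + 1) then (if 1 ≤ R ∧ e + 1 ∣ R then 1 else 0) else 0 := by
      intro m hm
      have hm' : m ≤ R / (e + 1) := by have := mem_range.1 hm; omega
      have hmul : m * (e + 1) ≤ R := (Nat.mul_le_mul_right _ hm').trans (Nat.div_mul_le_self _ _)
      rw [hW.zero _ _ (by omega)]
      by_cases hd : 1 ≤ R ∧ e + 1 ∣ R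
      · obtain ⟨hR1, q, rfl⟩ := hd
        rw [Nat.mul_div_cancel_left _ (by omega)]
        have hq : 0 < q := by rcases q with _ | q <;> simp_all
        by_cases hmq : m = q
        · subst hmq
          simp [hq.ne', mul_comm]
        · have : m < q := by
            rw [Nat.mul_div_cancel_left _ (by omega)] at hm'; omega
          have h3 : (e + 1) * q - m * (e + 1) ≠ 0 := by
            have : m * (e + 1) < (e + 1) * q := by rw [mul_comm]; gcongr
            omega
          simp [hmq, h3]
      · rw [if_neg hd, ite_self]
        by_cases hm0 : m = 0
        · simp [hm0]
        · rw [if_neg hm0, if_neg]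
          intro h
          have h5 : R = m * (e + 1) := by omega
          have : 0 < m * (e + 1) := by positivity
          exact hd ⟨by omega, h5 ▸ Dvd.intro_left m rfl⟩
    rw [sum_congr rfl key, sum_ite_eq' _ _ _, if_pos (by simp)]

/-- The number of partitions of `R` into parts `e + 1` and `e + 2`, the latter present. -/
theorem card_two_part_sizes (e R : ℕ) (hR : 1 ≤ R) :
    (∑ m ∈ range (R / (e + 1) + 1),
      if 1 ≤ R - m * (e + 1) ∧ e + 2 ∣ R - m * (e + 1) then 1 else 0) =
      (R - 1) / (e + 1) - (R - 1) / (e + 2) := by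
  rw [← card_filter, ← Nat.card_Ioc]
  -- With `m` parts `e + 1` and `q` parts `e + 2`, record the total number `N = m + q` of parts.
  -- Then `q = R - N (e + 1)`, and the condition `1 ≤ q ≤ N` describes the interval.
  refine card_nbij' (fun m => m + (R - m * (e + 1)) / (e + 2)) (fun N => N - (R - N * (e + 1)))
    ?_ ?_ ?_ ?_
  · intro m hm
    simp only [coe_filter, mem_range, Set.mem_ofPred_eq, coe_Ioc, Set.mem_Ioc] at hm ⊢
    obtain ⟨-, h1, q, hq⟩ := hm
    rw [hq, Nat.mul_div_cancel_left _ (by omega), Nat.div_lt_iff_lt_mul (by omega),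
      Nat.le_div_iff_mul_le (by omega)]
    have hq0 : 0 < q := by rcases q with _ | q <;> simp_all
    have : R = m * (e + 1) + (e + 2) * q := by omega
    subst this
    constructor
    · have : (m + q) * (e + 2) = m * (e + 1) + (e + 2) * q + m := by ring
      omega
    · have : m * (e + 1) + (e + 2) * q = (m + q) * (e + 1) + q := by ring
      omega
  · intro N hN
    simp only [coe_filter, mem_range, Set.mem_ofPred_eq, coe_Ioc, Set.mem_Ioc] at hN ⊢
    obtain ⟨h1, h2⟩ := hN
    rw [Nat.div_lt_iff_lt_mul (by omega)] at h1
    rw [Nat.le_div_iff_mul_le (by omega)] at h2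
    obtain ⟨q, hq⟩ : ∃ q, R = N * (e + 1) + q := ⟨R - N * (e + 1), by omega⟩
    have hq0 : 0 < q := by omega
    have h3 : N * (e + 2) = N * (e + 1) + N := by ring
    obtain ⟨m, rfl⟩ : ∃ m, N = m + q := ⟨N - q, by omega⟩
    have h4 : (m + q) * (e + 1) = m * (e + 1) + q * (e + 1) := by ring
    have h5 : R - (m + q) * (e + 1) = q := by omega
    have h6 : R - m * (e + 1) = (e + 2) * q := by
      have : (e + 2) * q = q * (e + 1) + q := by ring
      omega
    rw [h5, Nat.add_sub_cancel, h6]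
    refine ⟨?_, by nlinarith, Dvd.intro _ rfl⟩
    rw [Nat.lt_succ_iff, Nat.le_div_iff_mul_le (by omega)]
    omega
  · intro m hm
    simp only [coe_filter, mem_range, Set.mem_ofPred_eq] at hm ⊢
    obtain ⟨-, h1, q, hq⟩ := hm
    rw [hq, Nat.mul_div_cancel_left _ (by omega)]
    have : (e + 2) * q = q * (e + 1) + q := by ring
    have : (m + q) * (e + 1) = m * (e + 1) + q * (e + 1) := by ring
    omega
  · intro N hN
    simp only [coe_Ioc, Set.mem_Ioc] at hN ⊢
    obtain ⟨h1, h2⟩ := hN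
    rw [Nat.div_lt_iff_lt_mul (by omega)] at h1
    rw [Nat.le_div_iff_mul_le (by omega)] at h2
    obtain ⟨q, hq⟩ : ∃ q, R = N * (e + 1) + q := ⟨R - N * (e + 1), by omega⟩
    have h3 : N * (e + 2) = N * (e + 1) + N := by ring
    obtain ⟨m, rfl⟩ : ∃ m, N = m + q := ⟨N - q, by omega⟩
    have h4 : (m + q) * (e + 1) = m * (e + 1) + q * (e + 1) := by ring
    have h5 : R - (m + q) * (e + 1) = q := by omega
    have h6 : R - m * (e + 1) = (e + 2) * q := by
      have : (e + 2) * q = q * (e + 1) + q := by ring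
      omega
    rw [h5, Nat.add_sub_cancel, h6, Nat.mul_div_cancel_left _ (by omega)]

theorem IsScanCount.transfer_one {S : Finset ℕ} {n : ℕ} {W : ℕ → ℕ → ℕ → ℕ}
    (hW : IsScanCount S n W) (h0 : 0 ∈ S) (h1 : 1 ∉ S) (e R : ℕ) (he : e < n) (hR : R ≤ n)
    (hR1 : 1 ≤ R) : transfer S W 1 e R = (R - 1) / (e + 1) - (R - 1) / (e + 2) := by
  rw [← card_two_part_sizes e R hR1, transfer]
  refine sum_congr rfl fun m _ => ?_
  rw [if_neg (by tauto), hW.state_one h0 h1 _ _ (by omega) (by omega)]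

theorem abs_natDiv_sub_le (R d : ℕ) (hR : 1 ≤ R) (hd : 0 < d) :
    |(((R - 1) / d : ℕ) : ℝ) - (R : ℝ) / d| ≤ 1 := by
  have hd' : (0 : ℝ) < d := by exact_mod_cast hd
  have h1 : (R - 1) / d * d ≤ R - 1 := Nat.div_mul_le_self _ _
  have h2 : R - 1 < (R - 1) / d * d + d := Nat.lt_div_mul_add hd
  generalize (R - 1) / d = q at *
  have h1' : (q : ℝ) * d ≤ R := by exact_mod_cast (by omega : q * d ≤ R)
  have h2' : (R : ℝ) ≤ q * d + d := by exact_mod_cast (by omega : R ≤ q * d + d)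
  rw [abs_le]
  constructor
  · have : (R : ℝ) / d ≤ q + 1 := by rw [div_le_iff₀ hd']; linarith
    linarith
  · have : (q : ℝ) ≤ (R : ℝ) / d := by rw [le_div_iff₀ hd']; linarith
    linarith

/-- The base of the induction: the count is one floor or a difference of two floors, each within `1`
of its quotient. -/
theorem IsScanCount.state_two {S : Finset ℕ} {n : ℕ} {W : ℕ → ℕ → ℕ → ℕ} (hW : IsScanCount S n W)
    (h0 : 0 ∈ S) (h1 : 1 ∉ S) (e R : ℕ) (he : e ≤ n) (hR : R ≤ n) :
    |(W 2 e R : ℝ) - leadTerm S 2 e R| ≤ 2 := by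
  rcases Nat.eq_zero_or_pos R with rfl | hR1
  · rw [hW.eq_zero h0 1 e 0 he (Nat.zero_le _)]
    simp [leadTerm]
  have hf1 : freeCount S 1 = 1 := by simp [freeCount, h1]
  have h0e : (0 : ℝ) ≤ e := Nat.cast_nonneg e
  by_cases h2 : 2 ∈ S
  -- The differences of floors telescope from `e = n`, where the floor is `0`.
  · have hexact : W 2 e R = (R - 1) / (e + 1) := by
      clear h0e
      induction he using Nat.decreasingInduction with
      | self => rw [hW.eq_zero h0 1 n R le_rfl hR, Nat.div_eq_of_lt (by omega)]
      | of_succ e he ih =>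
        rw [hW.step 1 e R (by omega), if_pos h2, ih, hW.transfer_one h0 h1 e R (by omega) hR hR1]
        exact Nat.add_sub_of_le (Nat.div_le_div_left (by omega) (by omega))
    have hl : leadTerm S 2 e R = (R : ℝ) / ((e + 1 : ℕ) : ℝ) := by
      have hf2 : freeCount S 2 = 1 := by rw [freeCount, if_pos h2, hf1]
      simp [leadTerm, leadCoeff, h2, hf1, hf2, risingProd]
    rw [hexact, hl]
    linarith [abs_natDiv_sub_le R (e + 1) hR1 (by omega)]
  · have hl : leadTerm S 2 e R = (R : ℝ) / ((e + 1 : ℕ) : ℝ) - (R : ℝ) / ((e + 2 : ℕ) : ℝ) := by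
      have hf2 : freeCount S 2 = 2 := by rw [freeCount, if_neg h2, hf1]
      simp [leadTerm, leadCoeff, h2, hf2, risingProd, prod_range_succ]
      field_simp
      ring
    rcases he.eq_or_lt with rfl | he
    · rw [hW.eq_zero h0 1 e R le_rfl hR]
      have := leadTerm_le_of_le S 0 e R 0 (freeCount_pos S h1 1) (by omega)
      have h3 : leadCoeff S 2 = 1 := by simp [leadCoeff, h2]
      have h4 := leadTerm_nonneg S 2 e R
      rw [zero_add, h3] at this
      rw [Nat.cast_zero, zero_sub, abs_neg, abs_of_nonneg h4]
      simp at this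
      linarith
    · rw [hW.step 1 e R he, if_neg h2, zero_add, hW.transfer_one h0 h1 e R he hR hR1,
        Nat.cast_sub (Nat.div_le_div_left (by omega) (by omega)), hl]
      have a1 := abs_natDiv_sub_le R (e + 1) hR1 (by omega)
      have a2 := abs_natDiv_sub_le R (e + 2) hR1 (by omega)
      rw [abs_le] at *
      constructor <;> linarith [a1.1, a1.2, a2.1, a2.2]

/-! ### Error propagation and the asymptotics of the scan counts. -/

/-- Propagation of the error term through a transfer sum. -/
theorem IsScanCount.transfer_error {S : Finset ℕ} {n : ℕ} {W : ℕ → ℕ → ℕ → ℕ}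
    (i g : ℕ) (hg : g + 1 ≤ freeCount S (i + 2)) (C L : ℝ) (hC : 0 ≤ C) (hL : 1 ≤ L)
    (hB : ∀ e R, e ≤ n → R ≤ n → |(W (i + 2) e R : ℝ) - leadTerm S (i + 2) e R| ≤
      C * (((R : ℝ) * L) ^ i / ((e : ℝ) + 1) ^ g))
    (e R : ℕ) (he : e < R) (hR : R ≤ n) :
    |(transfer S W (i + 2) e R : ℝ) - leadCoeff S (i + 2) * (R : ℝ) ^ (i + 2) / (i + 2) /
        risingProd (freeCount S (i + 2) + 1) e| ≤
      (2 * C + leadCoeff S (i + 2)) * ((R : ℝ) ^ (i + 1) * L ^ i / ((e : ℝ) + 1) ^ (g + 1)) := by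
  set c := leadCoeff S (i + 2) with hc
  set f := freeCount S (i + 2) with hf
  have hc0 : 0 ≤ c := leadCoeff_nonneg _ _
  have he0 : (0 : ℝ) ≤ e := Nat.cast_nonneg e
  have hP := risingProd_pos f (e + 1)
  have hRpos : (0 : ℝ) < R := by exact_mod_cast (by omega : 0 < R)
  set T : ℕ → ℝ := fun m => if i + 2 ∈ S ∧ m = 0 then 0 else
    ((R - m * (e + 1) : ℕ) : ℝ) ^ (i + 1) with hT
  -- the sum of the leading terms
  have hsum : |∑ m ∈ range (R / (e + 1) + 1), T m - (R : ℝ) ^ (i + 2) / ((i + 2) * (e + 1))| ≤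
      (R : ℝ) ^ (i + 1) := by
    obtain ⟨b1, b2⟩ := sum_pow_arith_bounds (i + 1) (e + 1) (by omega) R
    have hden : ((i + 1 : ℕ) + 1 : ℝ) * ((e + 1 : ℕ) : ℝ) = ((i : ℝ) + 2) * (e + 1) := by
      push_cast; ring
    rw [hden] at b1 b2
    by_cases hs : i + 2 ∈ S
    · have hT' : ∑ m ∈ range (R / (e + 1) + 1), T m =
          ∑ m ∈ range (R / (e + 1) + 1), ((R - m * (e + 1) : ℕ) : ℝ) ^ (i + 1) -
            (R : ℝ) ^ (i + 1) := by
        rw [sum_range_succ', sum_range_succ' (fun m => ((R - m * (e + 1) : ℕ) : ℝ) ^ (i + 1))]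
        simp [hT, hs]
      rw [hT', abs_le]
      constructor <;> linarith
    · have hT' : ∑ m ∈ range (R / (e + 1) + 1), T m =
          ∑ m ∈ range (R / (e + 1) + 1), ((R - m * (e + 1) : ℕ) : ℝ) ^ (i + 1) := by
        simp [hT, hs]
      rw [hT', abs_le]
      constructor <;> linarith
  have hlead : c * (R : ℝ) ^ (i + 2) / (i + 2) / risingProd (f + 1) e =
      c / risingProd f (e + 1) * ((R : ℝ) ^ (i + 2) / ((i + 2) * (e + 1))) := by
    rw [risingProd_succ']; field_simp
  have hterm : ∀ m ∈ range (R / (e + 1) + 1),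
      |((if i + 2 ∈ S ∧ m = 0 then 0 else W (i + 2) (e + 1) (R - m * (e + 1)) : ℕ) : ℝ) -
        c / risingProd f (e + 1) * T m| ≤ C * (((R : ℝ) * L) ^ i / ((e : ℝ) + 1) ^ g) := by
    intro m _
    by_cases hm : i + 2 ∈ S ∧ m = 0
    · simp only [hT, if_pos hm]
      simp
      positivity
    · simp only [hT, if_neg hm]
      have := hB (e + 1) (R - m * (e + 1)) (by omega) (by omega)
      have hlt : leadTerm S (i + 2) (e + 1) (R - m * (e + 1)) =
          c / risingProd f (e + 1) * ((R - m * (e + 1) : ℕ) : ℝ) ^ (i + 1) := by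
        rw [leadTerm, show i + 2 - 1 = i + 1 by omega]; ring
      rw [← hlt]
      refine this.trans ?_
      have hle : ((R - m * (e + 1) : ℕ) : ℝ) ≤ R := by exact_mod_cast Nat.sub_le _ _
      push_cast
      gcongr
      linarith
  have h1 : |(transfer S W (i + 2) e R : ℝ) -
      c / risingProd f (e + 1) * ∑ m ∈ range (R / (e + 1) + 1), T m| ≤
      2 * C * ((R : ℝ) ^ (i + 1) * L ^ i / ((e : ℝ) + 1) ^ (g + 1)) := by
    rw [transfer, Nat.cast_sum, mul_sum, ← sum_sub_distrib]
    refine (abs_sum_le_sum_abs _ _).trans ((sum_le_card_nsmul _ _ _ hterm).trans ?_)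
    rw [card_range, nsmul_eq_mul]
    -- Here `e < R` matters: it lets the extra `1` in the number of terms be absorbed into `R / (e +
    -- 1)`.
    have hq : ((R / (e + 1) + 1 : ℕ) : ℝ) ≤ 2 * (R / ((e : ℝ) + 1)) := by
      have h3 : ((R / (e + 1) : ℕ) : ℝ) ≤ R / ((e : ℝ) + 1) := by
        have := @Nat.cast_div_le ℝ _ _ _ R (e + 1)
        push_cast at this; exact this
      have h4 : (1 : ℝ) ≤ R / ((e : ℝ) + 1) := by
        rw [le_div_iff₀ (by positivity)]
        have : ((e + 1 : ℕ) : ℝ) ≤ R := by exact_mod_cast he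
        push_cast at this; linarith
      push_cast; linarith
    calc _ ≤ 2 * (R / ((e : ℝ) + 1)) * (C * (((R : ℝ) * L) ^ i / ((e : ℝ) + 1) ^ g)) := by
          gcongr
      _ = _ := by rw [mul_pow, pow_succ _ i, pow_succ _ g]; field_simp
  have h2 : |c / risingProd f (e + 1) * ∑ m ∈ range (R / (e + 1) + 1), T m -
      c * (R : ℝ) ^ (i + 2) / (i + 2) / risingProd (f + 1) e| ≤
      c * ((R : ℝ) ^ (i + 1) * L ^ i / ((e : ℝ) + 1) ^ (g + 1)) := by
    rw [hlead, ← mul_sub, abs_mul, abs_of_nonneg (by positivity)]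
    have h3 : ((e : ℝ) + 1) ^ (g + 1) ≤ risingProd f (e + 1) := by
      calc ((e : ℝ) + 1) ^ (g + 1) ≤ ((e : ℝ) + 1) ^ f := pow_le_pow_right₀ (by linarith) hg
        _ ≤ (((e + 1 : ℕ) : ℝ) + 1) ^ f := by push_cast; gcongr; linarith
        _ ≤ _ := pow_le_risingProd _ _
    have h4 : (1 : ℝ) ≤ L ^ i := one_le_pow₀ hL
    calc _ ≤ c / risingProd f (e + 1) * (R : ℝ) ^ (i + 1) := by gcongr
      _ ≤ c / ((e : ℝ) + 1) ^ (g + 1) * ((R : ℝ) ^ (i + 1) * L ^ i) := by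
        gcongr
        exact le_mul_of_one_le_right (by positivity) h4
      _ = _ := by ring
  calc _ ≤ _ := abs_sub_le _ (c / risingProd f (e + 1) * ∑ m ∈ range (R / (e + 1) + 1), T m) _
    _ ≤ _ := add_le_add h1 h2
    _ = _ := by ring

theorem harmonic_mono {m n : ℕ} (hmn : m ≤ n) : (harmonic m : ℝ) ≤ harmonic n := by
  have : harmonic m ≤ harmonic n := by
    unfold harmonic
    exact sum_le_sum_of_subset_of_nonneg (range_subset_range.2 hmn) fun _ _ _ => by positivity
  exact_mod_cast this

theorem one_le_harmonic {n : ℕ} (hn : 1 ≤ n) : (1 : ℝ) ≤ harmonic n := by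
  simpa using harmonic_mono hn

/-- The scan counts agree with their leading terms, up to a power of `R` less and logarithms. -/
theorem IsScanCount.asymptotic (S : Finset ℕ) (h0 : 0 ∈ S) (h1 : 1 ∉ S) (i : ℕ) :
    ∃ (C : ℝ) (g : ℕ), 0 ≤ C ∧ g + 1 ≤ freeCount S (i + 2) ∧
      ∀ (n : ℕ) (W : ℕ → ℕ → ℕ → ℕ), 1 ≤ n → IsScanCount S n W → ∀ e R, e ≤ n → R ≤ n →
        |(W (i + 2) e R : ℝ) - leadTerm S (i + 2) e R| ≤
          C * (((R : ℝ) * (harmonic n : ℝ)) ^ i / ((e : ℝ) + 1) ^ g) := by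
  induction i with
  | zero =>
    refine ⟨2, 0, by norm_num, freeCount_pos S h1 1, fun n W _ hW e R he hR => ?_⟩
    simpa using hW.state_two h0 h1 e R he hR
  | succ i ih =>
    obtain ⟨C, g, hC, hg, hB⟩ := ih
    set c := leadCoeff S (i + 2) with hc
    set c' := leadCoeff S (i + 3) with hc'
    have hc0 : 0 ≤ c := leadCoeff_nonneg _ _
    have hc0' : 0 ≤ c' := leadCoeff_nonneg _ _
    have htrans : ∀ (n : ℕ) (W : ℕ → ℕ → ℕ → ℕ), 1 ≤ n → IsScanCount S n W → ∀ e R, e < R →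
        R ≤ n → |(transfer S W (i + 2) e R : ℝ) - leadCoeff S (i + 2) * (R : ℝ) ^ (i + 2) /
          (i + 2) / risingProd (freeCount S (i + 2) + 1) e| ≤
        (2 * C + c) * ((R : ℝ) ^ (i + 1) * (harmonic n : ℝ) ^ i / ((e : ℝ) + 1) ^ (g + 1)) :=
      fun n W hn hW e R he hR => transfer_error i g hg C _ hC (one_le_harmonic hn)
        (fun e R he hR => hB n W hn hW e R he hR) e R he hR
    have hpow : ∀ (n R : ℕ), 1 ≤ n → (R : ℝ) ^ (i + 1) * (harmonic n : ℝ) ^ i ≤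
        ((R : ℝ) * (harmonic n : ℝ)) ^ (i + 1) := by
      intro n R hn
      rw [mul_pow, pow_succ (harmonic n : ℝ)]
      have := one_le_harmonic hn
      gcongr
      exact le_mul_of_one_le_right (by positivity) this
    -- the trivial range
    have htriv : ∀ g', g' + 1 ≤ freeCount S (i + 3) → ∀ (n : ℕ) (W : ℕ → ℕ → ℕ → ℕ),
        IsScanCount S n W → ∀ e R, e ≤ n → R ≤ e →
        |(W (i + 3) e R : ℝ) - leadTerm S (i + 3) e R| ≤
          c' * ((R : ℝ) ^ (i + 1) / ((e : ℝ) + 1) ^ g') := by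
      intro g' hg' n W hW e R he hR
      rw [hW.eq_zero h0 (i + 2) e R he hR, Nat.cast_zero, zero_sub, abs_neg,
        abs_of_nonneg (leadTerm_nonneg _ _ _ _)]
      exact leadTerm_le_of_le S (i + 1) e R g' hg' (by omega)
    by_cases hs : i + 3 ∈ S
    · have hfc : freeCount S (i + 3) = freeCount S (i + 2) := if_pos hs
      have hg' : g + 1 ≤ freeCount S (i + 3) := by omega
      refine ⟨c' + (2 * C + c), g, by positivity, hg', fun n W hn hW e R he hR => ?_⟩
      have hLn := one_le_harmonic hn
      rcases le_or_gt R e with hRe | hRe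
      · refine (htriv g hg' n W hW e R he hRe).trans ?_
        have h2 : (R : ℝ) ^ (i + 1) ≤ ((R : ℝ) * (harmonic n : ℝ)) ^ (i + 1) := by
          gcongr
          exact le_mul_of_one_le_right (by positivity) hLn
        gcongr
        linarith
      -- Downward induction from `e = R`. The step at `e` costs a multiple of `1 / (e + 1) ^ (g +
      -- 1)`; keeping `1 / (e + 1) ^ g` outside leaves `1 / (e + 1)`, and these add up to a
      -- difference of harmonic numbers.
      · have key : ∀ e, e ≤ R → |(W (i + 3) e R : ℝ) - leadTerm S (i + 3) e R| ≤
            (c' + (2 * C + c) * ((harmonic R : ℝ) - harmonic e)) *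
              ((R : ℝ) ^ (i + 1) * (harmonic n : ℝ) ^ i / ((e : ℝ) + 1) ^ g) := by
          intro e he
          induction he using Nat.decreasingInduction with
          | self =>
            rw [sub_self, mul_zero, add_zero]
            refine (htriv g hg' n W hW R R hR le_rfl).trans ?_
            gcongr
            exact le_mul_of_one_le_right (by positivity) (one_le_pow₀ hLn)
          | of_succ e he ih =>
            have h2 := htrans n W hn hW e R he hR
            have h3 := leadTerm_sub_of_mem S (i + 1) e R hs (freeCount_pos S h1 _)
            have h4 : W (i + 3) e R = W (i + 3) (e + 1) R + transfer S W (i + 2) e R := by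
              rw [hW.step (i + 2) e R (by omega), if_pos hs]
            have h5 : (W (i + 3) e R : ℝ) - leadTerm S (i + 3) e R =
                ((W (i + 3) (e + 1) R : ℝ) - leadTerm S (i + 3) (e + 1) R) +
                ((transfer S W (i + 2) e R : ℝ) - leadCoeff S (i + 2) * (R : ℝ) ^ (i + 2) /
                  (i + 2) / risingProd (freeCount S (i + 2) + 1) e) := by
              rw [h4]
              push_cast at h3 ⊢
              have e2 : (i : ℝ) + 1 + 1 = i + 2 := by ring
              rw [e2] at h3
              linarith
            rw [h5]
            refine (abs_add_le _ _).trans ((add_le_add ih h2).trans ?_)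
            have hhe : (harmonic (e + 1) : ℝ) = harmonic e + 1 / ((e : ℝ) + 1) := by
              rw [harmonic_succ]; push_cast; rw [one_div]
            have h6 := harmonic_mono he
            have h7 : (c' + (2 * C + c) * ((harmonic R : ℝ) - harmonic (e + 1))) *
                ((R : ℝ) ^ (i + 1) * (harmonic n : ℝ) ^ i / (((e + 1 : ℕ) : ℝ) + 1) ^ g) ≤
                (c' + (2 * C + c) * ((harmonic R : ℝ) - harmonic (e + 1))) *
                ((R : ℝ) ^ (i + 1) * (harmonic n : ℝ) ^ i / ((e : ℝ) + 1) ^ g) := by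
              have : 0 ≤ (harmonic R : ℝ) - harmonic (e + 1) := by linarith
              push_cast
              gcongr
              linarith
            refine (add_le_add_left h7 _).trans (le_of_eq ?_)
            rw [hhe, pow_succ _ g]
            field_simp
            ring
        refine (key e hRe.le).trans ?_
        have hHR := harmonic_mono hR
        have hHe : (0 : ℝ) ≤ harmonic e := by
          have := harmonic_mono (Nat.zero_le e)
          simpa using this
        have h8 : c' + (2 * C + c) * ((harmonic R : ℝ) - harmonic e) ≤
            (c' + (2 * C + c)) * harmonic n := by
          have : (2 * C + c) * ((harmonic R : ℝ) - harmonic e) ≤ (2 * C + c) * harmonic n := by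
            gcongr; linarith
          nlinarith
        calc _ ≤ (c' + (2 * C + c)) * harmonic n *
              ((R : ℝ) ^ (i + 1) * (harmonic n : ℝ) ^ i / ((e : ℝ) + 1) ^ g) := by gcongr
          _ = _ := by rw [mul_pow]; ring
    · have hfc : freeCount S (i + 3) = freeCount S (i + 2) + 1 := if_neg hs
      have hg' : g + 1 + 1 ≤ freeCount S (i + 3) := by omega
      -- There is no sum over `e` here, so the whole power `g + 1` gained in the transfer is kept.
      refine ⟨c' + (2 * C + c), g + 1, by positivity, hg', fun n W hn hW e R he hR => ?_⟩
      have hLn := one_le_harmonic hn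
      rcases le_or_gt R e with hRe | hRe
      · refine (htriv (g + 1) hg' n W hW e R he hRe).trans ?_
        have h2 : (R : ℝ) ^ (i + 1) ≤ ((R : ℝ) * (harmonic n : ℝ)) ^ (i + 1) := by
          gcongr
          exact le_mul_of_one_le_right (by positivity) hLn
        gcongr
        linarith
      · have h2 := htrans n W hn hW e R hRe hR
        have h3 := leadTerm_of_notMem S (i + 1) e R hs
        push_cast at h3
        have e2 : (i : ℝ) + 1 + 1 = i + 2 := by ring
        rw [e2] at h3
        rw [hW.step (i + 2) e R (by omega), if_neg hs, zero_add, h3]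
        refine h2.trans ?_
        have := hpow n R hn
        have h4 : 2 * C + c ≤ c' + (2 * C + c) := by linarith
        gcongr

/-! ### The scan of a partition and its counting by final state. -/

/-- The state after `t` steps of the scan of the multiset `s` of parts, which treats the part
sizes `n, n - 1, …` in turn: in a state of `S` it waits for a part that is present, and otherwise
it moves on to the next state. -/
def scanSteps (S : Finset ℕ) (n : ℕ) (s : Multiset ℕ) : ℕ → ℕ
  | 0 => 0
  | t + 1 => if scanSteps S n s t ∈ S ∧ n - t ∉ s then scanSteps S n s t
      else scanSteps S n s t + 1

/-- The state after the part sizes `n, …, e + 1` have been treated. -/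
def scan (S : Finset ℕ) (n : ℕ) (s : Multiset ℕ) (e : ℕ) : ℕ := scanSteps S n s (n - e)

theorem scan_of_le (S : Finset ℕ) {n e : ℕ} (s : Multiset ℕ) (h : n ≤ e) : scan S n s e = 0 := by
  rw [scan, Nat.sub_eq_zero_of_le h, scanSteps]

theorem scan_step (S : Finset ℕ) {n e : ℕ} (s : Multiset ℕ) (h : e < n) :
    scan S n s e = if scan S n s (e + 1) ∈ S ∧ e + 1 ∉ s then scan S n s (e + 1)
      else scan S n s (e + 1) + 1 := by
  rw [scan, show n - e = (n - (e + 1)) + 1 by omega, scanSteps, ← scan,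
    show n - (n - (e + 1)) = e + 1 by omega]

theorem scan_congr (S : Finset ℕ) {n e : ℕ} {s s' : Multiset ℕ}
    (h : ∀ v, e < v → (v ∈ s ↔ v ∈ s')) : scan S n s e = scan S n s' e := by
  rcases le_total n e with hn | hn
  · rw [scan_of_le S s hn, scan_of_le S s' hn]
  induction hn using Nat.decreasingInduction with
  | self => rw [scan_of_le S s le_rfl, scan_of_le S s' le_rfl]
  | of_succ e he ih =>
    rw [scan_step S s he, scan_step S s' he, ih fun v hv => h v (by omega)]
    simp only [h (e + 1) (by omega)]

theorem scan_eq_zero_iff (S : Finset ℕ) (h0 : 0 ∈ S) {n e : ℕ} (s : Multiset ℕ) :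
    scan S n s e = 0 ↔ ∀ v, e < v → v ≤ n → v ∉ s := by
  rcases le_total n e with hn | hn
  · rw [scan_of_le S s hn]
    exact ⟨fun _ v _ _ => by omega, fun _ => rfl⟩
  induction hn using Nat.decreasingInduction with
  | self =>
    rw [scan_of_le S s le_rfl]
    exact ⟨fun _ v _ _ => by omega, fun _ => rfl⟩
  | of_succ e he ih =>
    rw [scan_step S s he]
    constructor
    · intro h v hv hvn
      split_ifs at h with h'
      rcases (show e + 1 ≤ v from hv).eq_or_lt with rfl | hlt
      · exact h'.2
      · exact ih.1 h v hlt hvn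
    · intro h
      have h2 : scan S n s (e + 1) = 0 := ih.2 fun v hv hvn => h v (by omega) hvn
      rw [h2, if_pos ⟨h0, h _ (by omega) he⟩]

/-- The partitions of `R` into parts in `(e, n]` whose scan down to `e + 1` ends in state `i`. -/
def scanClass (S : Finset ℕ) (n i e R : ℕ) : Finset (Nat.Partition R) :=
  univ.filter fun p => (∀ v ∈ p.parts, e < v ∧ v ≤ n) ∧ scan S n p.parts e = i

theorem mem_scanClass {S : Finset ℕ} {n i e R : ℕ} {p : Nat.Partition R} :
    p ∈ scanClass S n i e R ↔ (∀ v ∈ p.parts, e < v ∧ v ≤ n) ∧ scan S n p.parts e = i := by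
  simp [scanClass]

theorem card_scanClass_zero (S : Finset ℕ) (h0 : 0 ∈ S) (n e R : ℕ) :
    (scanClass S n 0 e R).card = if R = 0 then 1 else 0 := by
  split_ifs with hR
  · subst hR
    have : scanClass S n 0 e 0 = univ := by
      ext p
      simp only [mem_scanClass, scan_eq_zero_iff S h0, Nat.Partition.partition_zero_parts,
        Multiset.notMem_zero, mem_univ]
      tauto
    rw [this]
    simp
  · rw [card_eq_zero, eq_empty_iff_forall_notMem]
    intro p hp
    obtain ⟨h1, h2⟩ := mem_scanClass.1 hp
    have h3 : p.parts = 0 := Multiset.eq_zero_of_forall_notMem fun v hv =>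
      (scan_eq_zero_iff S h0 p.parts).1 h2 v (h1 v hv).1 (h1 v hv).2 hv
    have := p.parts_sum
    rw [h3] at this
    simp at this
    omega

/-- Removing the `m` parts equal to `e + 1`. -/
theorem card_scan_fiber (S : Finset ℕ) (n i e R m : ℕ) (he : e < n) (hm : m * (e + 1) ≤ R) :
    (univ.filter fun p : Nat.Partition R => (∀ v ∈ p.parts, e < v ∧ v ≤ n) ∧
      p.parts.count (e + 1) = m ∧ scan S n p.parts (e + 1) = i).card =
      (scanClass S n i (e + 1) (R - m * (e + 1))).card := by
  symm
  refine card_bij (fun q _ => ⟨q.parts + Multiset.replicate m (e + 1), ?_, ?_⟩) ?_ ?_ ?_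
  · intro v hv
    rcases Multiset.mem_add.1 hv with h | h
    · exact q.parts_pos h
    · rw [Multiset.eq_of_mem_replicate h]; omega
  · rw [Multiset.sum_add, q.parts_sum, Multiset.sum_replicate, smul_eq_mul]; omega
  · intro q hq
    obtain ⟨h1, h2⟩ := mem_scanClass.1 hq
    simp only [mem_filter, mem_univ, true_and]
    refine ⟨?_, ?_, ?_⟩
    · intro v hv
      rcases Multiset.mem_add.1 hv with h | h
      · have := h1 v h; omega
      · rw [Multiset.eq_of_mem_replicate h]; omega
    · rw [Multiset.count_add, Multiset.count_replicate_self, Multiset.count_eq_zero.2, zero_add]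
      intro h
      have := h1 _ h
      omega
    · rw [← h2]
      refine scan_congr S fun v hv => ?_
      rw [Multiset.mem_add]
      refine ⟨fun h => h.resolve_right fun h' => ?_, Or.inl⟩
      rw [Multiset.eq_of_mem_replicate h'] at hv
      omega
  · intro q _ q' _ h
    have := congrArg Nat.Partition.parts h
    exact Nat.Partition.ext (add_right_cancel this)
  · intro p hp
    simp only [mem_filter, mem_univ, true_and] at hp
    obtain ⟨h1, h2, h3⟩ := hp
    have hsplit : p.parts.filter (fun v => ¬ e + 1 = v) + Multiset.replicate m (e + 1) =
        p.parts := by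
      rw [← h2, ← Multiset.filter_eq, add_comm, Multiset.filter_add_not]
    refine ⟨⟨p.parts.filter (fun v => ¬ e + 1 = v), fun h => p.parts_pos (Multiset.mem_of_mem_filter h),
      ?_⟩, ?_, Nat.Partition.ext hsplit⟩
    · have := congrArg Multiset.sum hsplit
      rw [Multiset.sum_add, p.parts_sum, Multiset.sum_replicate, smul_eq_mul] at this
      omega
    · rw [mem_scanClass]
      refine ⟨fun v hv => ?_, ?_⟩
      · obtain ⟨h4, h5⟩ := Multiset.mem_filter.1 hv
        have := h1 v h4
        omega
      · rw [← h3]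
        refine scan_congr S fun v hv => ?_
        rw [Multiset.mem_filter]
        exact ⟨fun h => h.1, fun h => ⟨h, by omega⟩⟩

/-- Partitions are sorted by the multiplicity `m` of `e + 1`. Those already in state `i + 1` stay
there only if it is a waiting state and `m = 0`; those in state `i` advance unless it is a waiting
state and `m = 0`. -/
theorem isScanCount_card_scanClass (S : Finset ℕ) (h0 : 0 ∈ S) (n : ℕ) :
    IsScanCount S n fun i e R => (scanClass S n i e R).card where
  base i R := by
    rcases i with _ | i
    · simpa using card_scanClass_zero S h0 n n R
    · rw [if_neg (by omega), card_eq_zero, eq_empty_iff_forall_notMem]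
      intro p hp
      have := (mem_scanClass.1 hp).2
      rw [scan_of_le S _ le_rfl] at this
      omega
  zero e R _ := card_scanClass_zero S h0 n e R
  step i e R he := by
    have hmaps : ∀ p ∈ scanClass S n (i + 1) e R,
        p.parts.count (e + 1) ∈ range (R / (e + 1) + 1) := by
      intro p _
      rw [mem_range, Nat.lt_succ_iff, Nat.le_div_iff_mul_le (by omega)]
      have h := Multiset.filter_add_not (e + 1 = ·) p.parts
      have h' := congrArg Multiset.sum h
      rw [Multiset.filter_eq, Multiset.sum_add, Multiset.sum_replicate, p.parts_sum,
        smul_eq_mul] at h'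
      omega
    have hfib : ∀ m ∈ range (R / (e + 1) + 1),
        ((scanClass S n (i + 1) e R).filter fun p => p.parts.count (e + 1) = m).card =
        (if i ∈ S ∧ m = 0 then 0 else (scanClass S n i (e + 1) (R - m * (e + 1))).card) +
        (if m = 0 then if i + 1 ∈ S then (scanClass S n (i + 1) (e + 1) R).card else 0
          else 0) := by
      intro m hm
      have hm' : m * (e + 1) ≤ R := by
        rw [← Nat.le_div_iff_mul_le (by omega)]
        have := mem_range.1 hm
        omega
      have hmem : ∀ p : Nat.Partition R, p.parts.count (e + 1) = m → (e + 1 ∉ p.parts ↔ m = 0) :=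
        fun p hp => by rw [← hp, Multiset.count_eq_zero]
      rw [← card_scan_fiber S n i e R m he hm']
      have hfib0 := card_scan_fiber S n (i + 1) e R 0 he (by omega)
      rw [zero_mul, tsub_zero] at hfib0
      rw [← hfib0, ← ite_and]
      have e1 : ∀ (P : Prop) [Decidable P] (A : Finset (Nat.Partition R)),
          (if P then 0 else A.card) = (A.filter fun _ => ¬ P).card := by
        intro P _ A; by_cases hP : P <;> simp [hP]
      have e2 : ∀ (P : Prop) [Decidable P] (A : Finset (Nat.Partition R)),
          (if P then A.card else 0) = (A.filter fun _ => P).card := by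
        intro P _ A; by_cases hP : P <;> simp [hP]
      rw [e1, e2, ← card_union_of_disjoint]
      · congr 1
        ext p
        simp only [mem_filter, mem_union, mem_scanClass, mem_univ, true_and]
        rw [scan_step S p.parts he]
        constructor
        · rintro ⟨⟨h1, h2⟩, h3⟩
          simp only [hmem p h3] at h2
          split_ifs at h2 with h4
          · right
            rw [h2] at h4
            exact ⟨⟨h1, by omega, h2⟩, by tauto⟩
          · left
            have h5 : scan S n p.parts (e + 1) = i := by omega
            rw [h5] at h4
            exact ⟨⟨h1, h3, h5⟩, h4⟩
        · rintro (⟨⟨h1, h2, h3⟩, h4⟩ | ⟨⟨h1, h2, h3⟩, h4, h5⟩)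
          · simp only [hmem p h2, h3, if_neg h4]
            exact ⟨⟨h1, trivial⟩, h2⟩
          · simp only [hmem p (h2.trans h4.symm), h3, if_pos (And.intro h5 h4)]
            exact ⟨⟨h1, trivial⟩, by omega⟩
      · rw [disjoint_left]
        intro p hp hp'
        simp only [mem_filter] at hp hp'
        have h3 := hp.1.2.2.2
        have h4 := hp'.1.2.2.2
        omega
    show (scanClass S n (i + 1) e R).card = _
    rw [card_eq_sum_card_fiberwise hmaps, sum_congr rfl hfib, sum_add_distrib, add_comm, transfer,
      sum_ite_eq', if_pos (by simp)]

/-! ### Containment of `μ` in terms of the scan. -/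

/-- The scan states in which containing `μ` requires a new row, for `μ` with first part
`k + 1`. -/
def rowStates (μ : YoungDiagram) (k : ℕ) : Finset ℕ :=
  (range (μ.colLen 0)).image fun j => k + 1 - μ.rowLen j

theorem lt_colLen_zero_iff (μ : YoungDiagram) (j : ℕ) : j < μ.colLen 0 ↔ 0 < μ.rowLen j := by
  rw [← YoungDiagram.mem_iff_lt_colLen, YoungDiagram.mem_iff_lt_rowLen]

theorem mem_rowStates {μ : YoungDiagram} {k : ℕ} (hk : μ.rowLen 0 = k + 1) {t : ℕ} :
    t ∈ rowStates μ k ↔ ∃ j, 0 < μ.rowLen j ∧ μ.rowLen j + t = k + 1 := by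
  simp only [rowStates, mem_image, mem_range, lt_colLen_zero_iff]
  refine exists_congr fun j => and_congr_right fun _ => ?_
  have := μ.rowLen_anti 0 j (Nat.zero_le _)
  omega

theorem strict_lt {μ : YoungDiagram} (hμ : IsStrict μ) {i j : ℕ} (hij : i < j)
    (h : 0 < μ.rowLen i) : μ.rowLen j < μ.rowLen i := by
  refine lt_of_le_of_ne (μ.rowLen_anti i j hij.le) fun he => ?_
  have := hμ i j h he.symm
  omega

theorem sum_rowLens (α : YoungDiagram) : α.rowLens.sum = α.card := by
  have h : ∀ c ∈ α.cells, c.1 ∈ range (α.colLen 0) := by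
    rintro ⟨i, j⟩ hc
    rw [mem_range, lt_colLen_zero_iff]
    have := YoungDiagram.mem_iff_lt_rowLen.1 (show (i, j) ∈ α from hc)
    simp only
    omega
  rw [YoungDiagram.card, card_eq_sum_card_fiberwise h]
  have h2 : ∑ i ∈ range (α.colLen 0), α.rowLen i = α.rowLens.sum := rfl
  rw [← h2]
  exact sum_congr rfl fun i _ => α.rowLen_eq_card

theorem mem_rowLens {α : YoungDiagram} {v : ℕ} (hv : 0 < v) :
    v ∈ (α.rowLens : Multiset ℕ) ↔ ∃ r, α.rowLen r = v := by
  rw [Multiset.mem_coe, YoungDiagram.rowLens, List.mem_map]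
  simp only [List.mem_range, lt_colLen_zero_iff]
  exact ⟨fun ⟨r, _, h⟩ => ⟨r, h⟩, fun ⟨r, h⟩ => ⟨r, by omega, h⟩⟩

/-- Greedy placement is optimal: the scan is never behind any embedding of `μ`, and the sizes at
which it changes state provide an embedding. -/
theorem contains_iff_lt_scan {μ : YoungDiagram} (hμ : IsStrict μ) {k : ℕ}
    (hk : μ.rowLen 0 = k + 1) {α : YoungDiagram} {n : ℕ} (hn : ∀ r, α.rowLen r ≤ n) :
    Contains α μ ↔ k < scan (rowStates μ k) n α.rowLens 0 := by
  set S := rowStates μ k with hS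
  set σ : ℕ → ℕ := scan S n α.rowLens with hσ
  have h0 : 0 ∈ S := (mem_rowStates hk).2 ⟨0, by omega, by omega⟩
  have hstep : ∀ e, σ e = if σ (e + 1) ∈ S ∧ e + 1 ∉ (α.rowLens : Multiset ℕ) then σ (e + 1)
      else σ (e + 1) + 1 := by
    intro e
    rcases lt_or_ge e n with h | h
    · exact scan_step S _ h
    · have h1 : σ e = 0 := scan_of_le S _ h
      have h2 : σ (e + 1) = 0 := scan_of_le S _ (by omega)
      have h3 : e + 1 ∉ (α.rowLens : Multiset ℕ) := fun h3 => by
        obtain ⟨r, hr⟩ := (mem_rowLens (by omega)).1 h3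
        have := hn r
        omega
      rw [h1, h2, if_pos ⟨h0, h3⟩]
  have hle : ∀ e, σ (e + 1) ≤ σ e ∧ σ e ≤ σ (e + 1) + 1 := by
    intro e; rw [hstep e]; split_ifs <;> omega
  have hanti : Antitone σ := antitone_nat_of_succ_le fun e => (hle e).1
  have hpart : ∀ r, 0 < α.rowLen r → σ (α.rowLen r) ∈ S →
      σ (α.rowLen r - 1) = σ (α.rowLen r) + 1 := by
    intro r hr hs
    obtain ⟨v, hv⟩ : ∃ v, α.rowLen r = v + 1 := ⟨α.rowLen r - 1, by omega⟩
    have h2 : v + 1 ∈ (α.rowLens : Multiset ℕ) := (mem_rowLens (by omega)).2 ⟨r, hv⟩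
    rw [hv, Nat.add_sub_cancel, hstep v, if_neg (fun h => h.2 h2)]
  constructor
  · rintro ⟨r, c, hr, hc, h⟩
    have hiff : ∀ i j, c j < α.rowLen (r i) ↔ j < μ.rowLen i := fun i j => by
      rw [← YoungDiagram.mem_iff_lt_rowLen, h, YoungDiagram.mem_iff_lt_rowLen]
    -- On reaching the image of column `k + 1 - d` of an embedding, the scan has placed at least `d`
    -- columns.
    have key : ∀ d, d ≤ k + 1 → d ≤ σ (c (k + 1 - d)) := by
      intro d
      induction d with
      | zero => intro _; exact Nat.zero_le _
      | succ d ih =>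
        intro hd
        have ih' := ih (by omega)
        set q := k + 1 - (d + 1) with hq
        rw [show k + 1 - d = q + 1 by omega] at ih'
        have hcq : c q < c (q + 1) := hc (by omega)
        by_contra hlt
        by_cases hs : d ∈ S
        -- Row `j` of `μ` ends at column `q`, so the length of its image lies in `(c q, c (q + 1)]`.
        -- A scan waiting in state `d` finds that part in time.
        · obtain ⟨j, hj, hj'⟩ := (mem_rowStates hk).1 hs
          have h1 : c q < α.rowLen (r j) := (hiff j q).2 (by omega)
          have h2 : ¬ c (q + 1) < α.rowLen (r j) := fun h => by
            have := (hiff j (q + 1)).1 h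
            omega
          have h3 : σ (c (q + 1)) ≤ σ (α.rowLen (r j)) := hanti (by omega)
          have h4 : σ (α.rowLen (r j)) ≤ σ (c q) := hanti h1.le
          have h5 : σ (α.rowLen (r j)) = d := by omega
          have h6 := hpart (r j) (by omega) (h5 ▸ hs)
          have h7 : σ (α.rowLen (r j) - 1) ≤ σ (c q) := hanti (by omega)
          omega
        · have h4 : σ (c (q + 1)) ≤ σ (c q) := hanti hcq.le
          have h5 : σ (c (q + 1)) = d := by omega
          have h6 := hstep (c (q + 1) - 1)
          rw [show c (q + 1) - 1 + 1 = c (q + 1) by omega, h5, if_neg (fun h => hs h.1)] at h6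
          have h7 : σ (c (q + 1) - 1) ≤ σ (c q) := hanti (by omega)
          omega
    have h1 := key (k + 1) le_rfl
    have h2 : σ (c (k + 1 - (k + 1))) ≤ σ 0 := hanti (Nat.zero_le _)
    omega
  · intro hgt
    have hjump : ∀ t, ∃ e, t ≤ k → σ (e + 1) = t ∧ σ e = t + 1 := by
      intro t
      by_cases ht : t ≤ k
      · have hex : ∃ e, σ e ≤ t := ⟨n, by rw [hσ, scan_of_le S _ le_rfl]; exact Nat.zero_le _⟩
        have h1 := Nat.find_spec hex
        have h2 : Nat.find hex ≠ 0 := fun h => by rw [h] at h1; omega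
        obtain ⟨e, he⟩ := Nat.exists_eq_succ_of_ne_zero h2
        have h3 : ¬ σ e ≤ t := Nat.find_min hex (by omega)
        have h4 := hle e
        rw [he] at h1
        exact ⟨e, fun _ => by simp only [Nat.succ_eq_add_one] at h1; omega⟩
      · exact ⟨0, fun h => absurd h ht⟩
    choose x hx using hjump
    -- Column `q` goes where the scan leaves state `k - q`; columns beyond the first row of `μ` go
    -- outside the board `α`.
    set c : ℕ → ℕ := fun q => if q ≤ k then x (k - q) else n + q with hc
    have hcle : ∀ q, q ≤ k → σ (c q) = k + 1 - q ∧ σ (c q + 1) = k - q := by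
      intro q hq
      have := hx (k - q) (by omega)
      simp only [hc, if_pos hq]
      omega
    have hcmono : StrictMono c := by
      refine strictMono_nat_of_lt_succ fun q => ?_
      rcases lt_or_ge q k with hq | hq
      · by_contra hge
        have h1 : σ (c q) ≤ σ (c (q + 1)) := hanti (by omega)
        have h2 := hcle q (by omega)
        have h3 := hcle (q + 1) (by omega)
        omega
      · have h2 : c (q + 1) = n + (q + 1) := by simp only [hc]; rw [if_neg (by omega)]
        rcases hq.eq_or_lt with rfl | hq
        · by_contra hge
          have h3 : σ (c k) = 0 := scan_of_le S _ (by omega)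
          have h4 := hcle k le_rfl
          omega
        · have h3 : c q = n + q := by simp only [hc]; rw [if_neg (by omega)]
          omega
    have hrow : ∀ j, ∃ r, 0 < μ.rowLen j → α.rowLen r = c (μ.rowLen j - 1) + 1 := by
      intro j
      by_cases hj : 0 < μ.rowLen j
      · have h1 := μ.rowLen_anti 0 j (Nat.zero_le _)
        obtain ⟨h2, h3⟩ := hcle (μ.rowLen j - 1) (by omega)
        have h4 := hstep (c (μ.rowLen j - 1))
        have h5 : σ (c (μ.rowLen j - 1) + 1) ∈ S := by
          rw [h3]; exact (mem_rowStates hk).2 ⟨j, hj, by omega⟩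
        have h6 : c (μ.rowLen j - 1) + 1 ∈ (α.rowLens : Multiset ℕ) := by
          by_contra hn
          rw [if_pos ⟨h5, hn⟩] at h4
          omega
        obtain ⟨r, hr⟩ := (mem_rowLens (by omega)).1 h6
        exact ⟨r, fun _ => hr⟩
      · exact ⟨0, fun h => absurd h hj⟩
    choose y hy using hrow
    -- Empty rows of `μ` go to rows below the board `α`.
    set r : ℕ → ℕ := fun j => if 0 < μ.rowLen j then y j else α.colLen 0 + j with hr
    have hrpos : ∀ j, 0 < μ.rowLen j → α.rowLen (r j) = c (μ.rowLen j - 1) + 1 := by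
      intro j hj
      simp only [hr, if_pos hj]
      exact hy j hj
    refine ⟨r, c, ?_, hcmono, ?_⟩
    · refine strictMono_nat_of_lt_succ fun j => ?_
      by_cases hj1 : 0 < μ.rowLen (j + 1)
      · have hj : 0 < μ.rowLen j := lt_of_lt_of_le hj1 (μ.rowLen_anti _ _ (by omega))
        have hlt := strict_lt hμ (show j < j + 1 by omega) hj
        have h1 := hrpos j hj
        have h2 := hrpos (j + 1) hj1
        have h3 : c (μ.rowLen (j + 1) - 1) < c (μ.rowLen j - 1) := hcmono (by omega)
        by_contra hge
        have := α.rowLen_anti (r (j + 1)) (r j) (by omega)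
        omega
      · have h2 : r (j + 1) = α.colLen 0 + (j + 1) := by simp only [hr]; rw [if_neg hj1]
        by_cases hj : 0 < μ.rowLen j
        · have h1 := hrpos j hj
          have h3 : r j < α.colLen 0 := (lt_colLen_zero_iff α _).2 (by omega)
          omega
        · have h1 : r j = α.colLen 0 + j := by simp only [hr]; rw [if_neg hj]
          omega
    · intro j q
      rw [YoungDiagram.mem_iff_lt_rowLen, YoungDiagram.mem_iff_lt_rowLen]
      by_cases hj : 0 < μ.rowLen j
      · rw [hrpos j hj, Nat.lt_succ_iff, hcmono.le_iff_le]
        omega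
      · have h1 : r j = α.colLen 0 + j := by simp only [hr]; rw [if_neg hj]
        have h2 : ¬ 0 < α.rowLen (r j) := by
          rw [← lt_colLen_zero_iff]; omega
        omega

theorem rowLen_le_card (α : YoungDiagram) (r : ℕ) : α.rowLen r ≤ α.card := by
  rw [YoungDiagram.rowLen_eq_card]
  exact card_le_card (filter_subset _ _)

/-- The row lengths turn boards into partitions, and since no part exceeds the weight, the scan may
start at `n`. -/
theorem ncard_Av_eq_card {μ : YoungDiagram} (hμ : IsStrict μ) {k : ℕ}
    (hk : μ.rowLen 0 = k + 1) (n : ℕ) :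
    (Av n μ).ncard = (univ.filter fun p : Nat.Partition n =>
      scan (rowStates μ k) n p.parts 0 ≤ k).card := by
  rw [← Set.ncard_coe_finset]
  refine Set.ncard_congr (fun α hα => ⟨α.rowLens, ?_, ?_⟩) ?_ ?_ ?_
  · intro v hv
    exact α.pos_of_mem_rowLens v hv
  · rw [Multiset.sum_coe, sum_rowLens, hα.1]
  · rintro α ⟨h1, h2⟩
    rw [contains_iff_lt_scan hμ hk (n := n) fun r => h1 ▸ rowLen_le_card α r] at h2
    simpa using h2
  · intro α β _ _ h
    have h1 : (α.rowLens : Multiset ℕ) = β.rowLens := congrArg Nat.Partition.parts h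
    have h2 : α.rowLens = β.rowLens :=
      (Multiset.coe_eq_coe.1 h1).eq_of_pairwise' α.rowLens_sorted.pairwise β.rowLens_sorted.pairwise
    exact YoungDiagram.equivListRowLens.injective (Subtype.ext h2)
  · intro p hp
    have hp' : scan (rowStates μ k) n p.parts 0 ≤ k := by simpa using hp
    have hsort : (p.parts.sort (· ≥ ·)).SortedGE :=
      (Multiset.pairwise_sort p.parts (· ≥ ·)).sortedGE
    have hpos : ∀ v ∈ p.parts.sort (· ≥ ·), 0 < v := fun v hv =>
      p.parts_pos ((Multiset.mem_sort _).1 hv)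
    have hrl := YoungDiagram.rowLens_ofRowLens_eq_self (hw := hsort) hpos
    set α := YoungDiagram.ofRowLens _ hsort
    have hparts : (α.rowLens : Multiset ℕ) = p.parts := by rw [hrl, Multiset.sort_eq]
    have hcard : α.card = n := by
      rw [← sum_rowLens, ← Multiset.sum_coe, hparts, p.parts_sum]
    refine ⟨α, ⟨hcard, ?_⟩, Nat.Partition.ext hparts⟩
    rw [contains_iff_lt_scan hμ hk (n := n) fun r => hcard ▸ rowLen_le_card α r, hparts]
    omega

theorem ncard_Av_eq_sum {μ : YoungDiagram} (hμ : IsStrict μ) {k : ℕ}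
    (hk : μ.rowLen 0 = k + 1) (n : ℕ) :
    (Av n μ).ncard = ∑ i ∈ range (k + 1), (scanClass (rowStates μ k) n i 0 n).card := by
  rw [ncard_Av_eq_card hμ hk n, card_eq_sum_card_fiberwise (t := range (k + 1))
    (f := fun p : Nat.Partition n => scan (rowStates μ k) n p.parts 0)]
  · refine sum_congr rfl fun i hi => ?_
    congr 1
    ext p
    have := mem_range.1 hi
    simp only [mem_filter, mem_univ, true_and, mem_scanClass]
    constructor
    · rintro ⟨_, h⟩
      exact ⟨fun v hv => ⟨p.parts_pos hv, p.le_of_mem_parts hv⟩, h⟩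
    · rintro ⟨_, h⟩
      exact ⟨by omega, h⟩
  · intro p hp
    simp only [coe_filter, mem_univ, true_and, Set.mem_ofPred_eq] at hp
    simp only [coe_range, Set.mem_Iio]
    omega

/-! ### The constant of the main term. -/

theorem zero_mem_rowStates {k : ℕ} {μ : YoungDiagram} (hk : μ.rowLen 0 = k + 1) :
    0 ∈ rowStates μ k := (mem_rowStates hk).2 ⟨0, by omega, by omega⟩

theorem one_notMem_rowStates {k : ℕ} {μ : YoungDiagram} (hk : μ.rowLen 0 = k + 1)
    (h : μ.rowLen 1 < k) : 1 ∉ rowStates μ k := by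
  intro hmem
  obtain ⟨j, -, hj⟩ := (mem_rowStates hk).1 hmem
  rcases j with _ | j
  · omega
  · have := μ.rowLen_anti 1 (j + 1) (by omega)
    omega

/-- The constants of the leading term in state `i + 1`, in terms of the parts of `μ`. -/
theorem leadCoeff_rowStates {k : ℕ} {μ : YoungDiagram} (hμ : IsStrict μ) {a : ℕ → ℕ}
    (ha : ∀ j : ℕ, a j = μ.rowLen (j + 1)) (hk : μ.rowLen 0 = k + 1) (hka : a 0 < k) (i : ℕ)
    (hi : i + 1 ≤ k) :
    ∃ A, (∀ j < A, k + 1 ≤ a j + (i + 1)) ∧ a A + (i + 1) ≤ k ∧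
      freeCount (rowStates μ k) (i + 1) + A = i + 1 ∧
      leadCoeff (rowStates μ k) (i + 1) *
        (i.factorial * ∏ j ∈ range A, ((k : ℝ) - ((a j : ℝ) + j))) = 1 := by
  have hmem : ∀ t, t ≤ k → (t + 1 ∈ rowStates μ k ↔ ∃ j, 0 < a j ∧ a j + t = k) := by
    intro t ht
    rw [mem_rowStates hk]
    constructor
    · rintro ⟨j, h1, h2⟩
      rcases j with _ | j
      · omega
      · exact ⟨j, by rw [ha]; exact h1, by rw [ha]; omega⟩
    · rintro ⟨j, h1, h2⟩
      rw [ha] at h1 h2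
      exact ⟨j + 1, h1, by omega⟩
  have h1S : 1 ∉ rowStates μ k :=
    one_notMem_rowStates hk (by rw [← zero_add 1, ← ha]; exact hka)
  induction i with
  | zero => exact ⟨0, by simp, by omega, by simp [freeCount, h1S], by simp [leadCoeff]⟩
  | succ i ih =>
    obtain ⟨A, h1, h2, h3, h4⟩ := ih (by omega)
    by_cases hs : i + 2 ∈ rowStates μ k
    -- `A` counts the waiting states of `[1, i + 1]`, one for each of the parts `a 0, …, a (A - 1)`.
    -- By strictness the part behind the new waiting state is `a A`.
    · obtain ⟨j, hj, hj'⟩ := (hmem (i + 1) (by omega)).1 hs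
      have hAj : A ≤ j := by
        by_contra hlt
        have := h1 j (by omega)
        omega
      have hj0 := hj
      rw [ha] at hj0
      have hpos : 0 < a A := by
        have := μ.rowLen_anti (A + 1) (j + 1) (by omega)
        rw [ha]; omega
      have hA : A = j := by
        by_contra hne
        have := strict_lt hμ (show A + 1 < j + 1 by omega) (by rw [← ha]; exact hpos)
        rw [← ha, ← ha] at this
        omega
      subst hA
      have hlt := strict_lt hμ (show A + 1 < A + 1 + 1 by omega) (by rw [← ha]; exact hpos)
      rw [← ha, ← ha] at hlt
      have hf := freeCount_pos _ h1S i
      refine ⟨A + 1, fun j hjA => ?_, by omega, ?_, ?_⟩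
      · rcases (Nat.lt_succ_iff.1 hjA).eq_or_lt with rfl | h
        · omega
        · have := h1 j h
          omega
      · have : freeCount (rowStates μ k) (i + 2) = freeCount (rowStates μ k) (i + 1) := if_pos hs
        show freeCount (rowStates μ k) (i + 2) + _ = _
        omega
      -- Since `a A = k - (i + 1)` and `freeCount + A = i + 1`, the new factor of the product is the
      -- free count by which `leadCoeff` divides.
      · have hfr : (k : ℝ) - ((a A : ℝ) + A) = freeCount (rowStates μ k) (i + 1) := by
          have : k = freeCount (rowStates μ k) (i + 1) + (a A + A) := by omega
          have : (k : ℝ) = freeCount (rowStates μ k) (i + 1) + (a A + A) := by exact_mod_cast this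
          linarith
        have hf0 : (freeCount (rowStates μ k) (i + 1) : ℝ) ≠ 0 := by positivity
        have hc : leadCoeff (rowStates μ k) (i + 1 + 1) = leadCoeff (rowStates μ k) (i + 1) /
            ((i + 1) * freeCount (rowStates μ k) (i + 1)) := by rw [leadCoeff, if_pos hs]
        rw [hc, prod_range_succ, hfr, Nat.factorial_succ]
        refine Eq.trans ?_ h4
        push_cast
        field_simp
    · have hne : a A + (i + 1) ≠ k := fun h => hs ((hmem (i + 1) (by omega)).2 ⟨A, by omega, h⟩)
      refine ⟨A, fun j hj => (h1 j hj).trans (by omega), by omega, ?_, ?_⟩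
      · have : freeCount (rowStates μ k) (i + 2) = freeCount (rowStates μ k) (i + 1) + 1 :=
          if_neg hs
        show freeCount (rowStates μ k) (i + 2) + _ = _
        omega
      · have hc : leadCoeff (rowStates μ k) (i + 1 + 1) =
            leadCoeff (rowStates μ k) (i + 1) / (i + 1) := by rw [leadCoeff, if_neg hs]
        rw [hc, Nat.factorial_succ]
        refine Eq.trans ?_ h4
        push_cast
        field_simp

theorem prod_sub_eq_factorial (k A : ℕ) (hA : A ≤ k) :
    ∏ j ∈ Ico A k, ((k : ℝ) - j) = ((k - A).factorial : ℝ) := by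
  obtain ⟨d, rfl⟩ := Nat.exists_eq_add_of_le hA
  rw [Nat.add_sub_cancel_left, prod_Ico_eq_prod_range, Nat.add_sub_cancel_left,
    ← prod_range_reflect, ← prod_range_add_one_eq_factorial, Nat.cast_prod]
  refine prod_congr rfl fun j hj => ?_
  have := mem_range.1 hj
  have h2 : ((d - 1 - j : ℕ) : ℝ) + (j + 1) = d := by
    exact_mod_cast (by omega : d - 1 - j + (j + 1) = d)
  push_cast
  linarith

/-- The leading term in state `k`. -/
theorem leadTerm_rowStates {k : ℕ} {μ : YoungDiagram} (hμ : IsStrict μ) {a : ℕ → ℕ}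
    (ha : ∀ j : ℕ, a j = μ.rowLen (j + 1)) (hk : μ.rowLen 0 = k + 1) (hka : a 0 < k) (n : ℕ) :
    leadTerm (rowStates μ k) k 0 n = (n : ℝ) ^ (k - 1) /
      (((k - 1).factorial : ℝ) * ∏ j ∈ range k, ((k : ℝ) - ((a j : ℝ) + (j : ℝ)))) := by
  obtain ⟨A, -, h2, h3, h4⟩ := leadCoeff_rowStates hμ ha hk hka (k - 1) (by omega)
  rw [show k - 1 + 1 = k by omega] at h2 h3 h4
  -- In state `k` all positive parts are used up; the remaining factors `k - j` with `j ≥ A`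
  -- multiply to `(k - A)!`, which is `risingProd` at `e = 0`.
  have hA0 : a A = 0 := by omega
  have hzero : ∀ j ∈ Ico A k, (k : ℝ) - ((a j : ℝ) + j) = k - j := by
    intro j hj
    have h5 := μ.rowLen_anti (A + 1) (j + 1) (by have := (mem_Ico.1 hj).1; omega)
    rw [← ha, ← ha] at h5
    have : a j = 0 := by omega
    simp [this]
  have hf : freeCount (rowStates μ k) k = k - A := by omega
  rw [leadTerm, risingProd_zero_right, hf, ← prod_range_mul_prod_Ico _ (show A ≤ k by omega),
    prod_congr rfl hzero, prod_sub_eq_factorial k A (by omega)]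
  have hc : leadCoeff (rowStates μ k) k =
      1 / (((k - 1).factorial : ℝ) * ∏ j ∈ range A, ((k : ℝ) - ((a j : ℝ) + j))) :=
    eq_one_div_of_mul_eq_one_left h4
  rw [hc, one_div_mul_eq_div, div_div, mul_assoc]

/-! ### The total error and the theorem. -/

/-- The number of partitions whose scan ends in a state below the last one is negligible. -/
theorem card_scanClass_le (S : Finset ℕ) (h0 : 0 ∈ S) (h1 : 1 ∉ S) (K i : ℕ) (hi : i < K + 2) :
    ∃ D : ℝ, ∀ n : ℕ, 1 ≤ n →
      ((scanClass S n i 0 n).card : ℝ) ≤ D * ((n : ℝ) * (harmonic n : ℝ)) ^ K := by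
  have hx : ∀ n : ℕ, 1 ≤ n → (1 : ℝ) ≤ (n : ℝ) * (harmonic n : ℝ) := fun n hn =>
    one_le_mul_of_one_le_of_one_le (by exact_mod_cast hn) (one_le_harmonic hn)
  match i with
  | 0 =>
    refine ⟨0, fun n hn => ?_⟩
    rw [card_scanClass_zero S h0, if_neg (by omega)]
    simp
  | 1 =>
    refine ⟨1, fun n hn => ?_⟩
    have h := (isScanCount_card_scanClass S h0 n).state_one h0 h1 0 n (Nat.zero_le _) le_rfl
    rw [h, if_pos ⟨hn, by simp⟩, one_mul, Nat.cast_one]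
    exact one_le_pow₀ (hx n hn)
  | i + 2 =>
    obtain ⟨C, g, hC, -, hB⟩ := IsScanCount.asymptotic S h0 h1 i
    refine ⟨C + leadCoeff S (i + 2), fun n hn => ?_⟩
    have h := hB n _ hn (isScanCount_card_scanClass S h0 n) 0 n (Nat.zero_le _) le_rfl
    simp only [Nat.cast_zero, zero_add, one_pow, div_one] at h
    have h2 := (abs_le.1 h).2
    have h3 : leadTerm S (i + 2) 0 n ≤ leadCoeff S (i + 2) * (n : ℝ) ^ (i + 1) := by
      rw [leadTerm, risingProd_zero_right]
      refine div_le_self (mul_nonneg (leadCoeff_nonneg _ _) (by positivity)) ?_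
      exact_mod_cast Nat.one_le_iff_ne_zero.2 (Nat.factorial_ne_zero _)
    have h4 : (n : ℝ) ^ (i + 1) ≤ ((n : ℝ) * (harmonic n : ℝ)) ^ K := by
      calc (n : ℝ) ^ (i + 1) ≤ ((n : ℝ) * (harmonic n : ℝ)) ^ (i + 1) := by
            gcongr
            exact le_mul_of_one_le_right (by positivity) (one_le_harmonic hn)
        _ ≤ _ := pow_le_pow_right₀ (hx n hn) (by omega)
    have h5 : ((n : ℝ) * (harmonic n : ℝ)) ^ i ≤ ((n : ℝ) * (harmonic n : ℝ)) ^ K :=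
      pow_le_pow_right₀ (hx n hn) (by omega)
    have h6 := mul_le_mul_of_nonneg_left h4 (leadCoeff_nonneg S (i + 2))
    have h7 := mul_le_mul_of_nonneg_left h5 hC
    rw [add_mul]
    linarith

/-- The sum of the scan counts of the states up to `K + 2` is its leading term up to an error
that is smaller by a factor `n`, up to logarithms. -/
theorem sum_card_scanClass_error (S : Finset ℕ) (h0 : 0 ∈ S) (h1 : 1 ∉ S) (K : ℕ) :
    ∃ D : ℝ, ∀ n : ℕ, 1 ≤ n →
      |((∑ i ∈ range (K + 3), (scanClass S n i 0 n).card : ℕ) : ℝ) - leadTerm S (K + 2) 0 n| ≤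
        D * ((n : ℝ) * (harmonic n : ℝ)) ^ K := by
  obtain ⟨C, g, hC, -, hB⟩ := IsScanCount.asymptotic S h0 h1 K
  choose! D hD using card_scanClass_le S h0 h1 K
  refine ⟨∑ i ∈ range (K + 2), D i + C, fun n hn => ?_⟩
  have h := hB n _ hn (isScanCount_card_scanClass S h0 n) 0 n (Nat.zero_le _) le_rfl
  simp only [Nat.cast_zero, zero_add, one_pow, div_one] at h
  have h2 : ∑ i ∈ range (K + 2), ((scanClass S n i 0 n).card : ℝ) ≤
      (∑ i ∈ range (K + 2), D i) * ((n : ℝ) * (harmonic n : ℝ)) ^ K := by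
    rw [sum_mul]
    exact sum_le_sum fun i hi => hD i (mem_range.1 hi) n hn
  have h3 : 0 ≤ ∑ i ∈ range (K + 2), ((scanClass S n i 0 n).card : ℝ) :=
    sum_nonneg fun _ _ => Nat.cast_nonneg _
  rw [sum_range_succ, Nat.cast_add, Nat.cast_sum, add_sub_assoc, add_mul]
  refine (abs_add_le _ _).trans (add_le_add ?_ h)
  rwa [abs_of_nonneg h3]

/-- The divisor `n` alone gives `n ^ K ≤ σ_K(n)`, and `H_n ≤ 2 log n` for `n ≥ 3`; one logarithm is
to spare. -/
theorem isBigO_sigma_mul_log (K : ℕ) :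
    (fun n : ℕ => ((n : ℝ) * (harmonic n : ℝ)) ^ K) =O[Filter.atTop] fun n : ℕ =>
      (ArithmeticFunction.sigma K n : ℝ) * Real.log (n : ℝ) ^ (K + 1) := by
  refine Asymptotics.IsBigO.of_bound (2 ^ K) ?_
  filter_upwards [Filter.eventually_ge_atTop 3] with n hn
  have hn' : (3 : ℝ) ≤ n := by exact_mod_cast hn
  have hlog : 1 ≤ Real.log n := by
    rw [Real.le_log_iff_exp_le (by linarith)]
    linarith [Real.exp_one_lt_three]
  have hH1 := one_le_harmonic (show 1 ≤ n by omega)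
  have hH : (harmonic n : ℝ) ≤ 2 * Real.log n := by
    linarith [harmonic_le_one_add_log n]
  have hs : (n : ℝ) ^ K ≤ (ArithmeticFunction.sigma K n : ℝ) := by
    have : n ^ K ≤ ArithmeticFunction.sigma K n := by
      rw [ArithmeticFunction.sigma_apply]
      exact single_le_sum (f := fun d => d ^ K) (fun _ _ => Nat.zero_le _)
        (Nat.mem_divisors_self n (by omega))
    exact_mod_cast this
  rw [Real.norm_of_nonneg (by positivity), Real.norm_of_nonneg (by positivity), mul_pow]
  calc (n : ℝ) ^ K * (harmonic n : ℝ) ^ K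
      ≤ (ArithmeticFunction.sigma K n : ℝ) * (2 * Real.log n) ^ K := by gcongr
    _ = 2 ^ K * ((ArithmeticFunction.sigma K n : ℝ) * Real.log n ^ K) := by rw [mul_pow]; ring
    _ ≤ _ := by
      gcongr
      omega

/-- Only the partition into ones avoids the pattern of a single row of length two. -/
theorem ncard_Av_of_rowLen_eq_two {μ : YoungDiagram} (hμ : IsStrict μ) (hk : μ.rowLen 0 = 1 + 1)
    (h : μ.rowLen 1 < 1) (n : ℕ) : (Av n μ).ncard = 1 := by
  have h0 := zero_mem_rowStates hk
  have h1 := one_notMem_rowStates hk h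
  rw [ncard_Av_eq_sum hμ hk, sum_range_succ, sum_range_one, card_scanClass_zero _ h0]
  have h2 := (isScanCount_card_scanClass _ h0 n).state_one h0 h1 0 n (Nat.zero_le _) le_rfl
  rw [h2]
  rcases Nat.eq_zero_or_pos n with rfl | hn
  · simp
  · rw [if_neg hn.ne', if_pos ⟨hn, by simp⟩]

end PartitionPattern

theorem theorem4p7 (k : ℕ) (μ : YoungDiagram) (hμ : PartitionPattern.IsStrict μ)
    (a : ℕ → ℕ) (ha : ∀ j : ℕ, a j = μ.rowLen (j + 1))
    (hk : μ.rowLen 0 = k + 1) (hka : a 0 < k) :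
    ∃ E : ℕ → ℝ,
      (∀ n : ℕ, ((PartitionPattern.Av n μ).ncard : ℝ) =
        (n : ℝ) ^ (k - 1) /
          (((k - 1).factorial : ℝ) *
            ∏ j ∈ Finset.range k, ((k : ℝ) - ((a j : ℝ) + (j : ℝ)))) + E n) ∧
      (k = 1 → ∀ n : ℕ, E n = 0) ∧
      (k = 2 → E =O[Filter.atTop] fun _ : ℕ => (1 : ℝ)) ∧
      (3 ≤ k → E =O[Filter.atTop] fun n : ℕ =>
        (ArithmeticFunction.sigma (k - 2) n : ℝ) * Real.log (n : ℝ) ^ (k - 1)) := by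
  open PartitionPattern in
  have h0 := zero_mem_rowStates hk
  have hka' : μ.rowLen 1 < k := by rw [← zero_add 1, ← ha]; exact hka
  have h1 := one_notMem_rowStates hk hka'
  refine ⟨fun n => ((Av n μ).ncard : ℝ) - (n : ℝ) ^ (k - 1) / (((k - 1).factorial : ℝ) *
    ∏ j ∈ Finset.range k, ((k : ℝ) - ((a j : ℝ) + (j : ℝ)))), fun n => by ring, ?_, ?_⟩
  · rintro rfl n
    have ha0 : a 0 = 0 := by omega
    simp [ncard_Av_of_rowLen_eq_two hμ hk hka' n, ha0]
  · suffices h : ∀ K, k = K + 2 → (fun n : ℕ => ((Av n μ).ncard : ℝ) - (n : ℝ) ^ (k - 1) /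
        (((k - 1).factorial : ℝ) * ∏ j ∈ Finset.range k, ((k : ℝ) - ((a j : ℝ) + (j : ℝ)))))
        =O[Filter.atTop] fun n : ℕ => ((n : ℝ) * (harmonic n : ℝ)) ^ K by
      constructor
      · intro hk2
        simpa using h 0 hk2
      · intro hk3
        have := (h (k - 2) (by omega)).trans (isBigO_sigma_mul_log (k - 2))
        rwa [show k - 2 + 1 = k - 1 by omega] at this
    rintro K rfl
    obtain ⟨D, hD⟩ := sum_card_scanClass_error _ h0 h1 K
    refine Asymptotics.IsBigO.of_bound D ?_
    filter_upwards [Filter.eventually_ge_atTop 1] with n hn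
    have hH := one_le_harmonic hn
    have := hD n hn
    rw [← leadTerm_rowStates hμ ha hk hka n, ncard_Av_eq_sum hμ hk n, Real.norm_eq_abs,
      Real.norm_of_nonneg (by positivity)]
    exact this
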